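/- Let $\gamma^0,\gamma^1,\gamma^2,\gamma^3\in\mathbb C^{4\times 4}$ be Dirac matrices, i.e. $\gamma^\mu\gamma^\nu+\gamma^\nu\gamma^\mu=2g^{\mu\nu}\mathbf 1$ with $g=\mathrm{diag}(1,-1,-1,-1)$, $\gamma^0$ Hermitian and $\gamma^1,\gamma^2,\gamma^3$ anti-Hermitian. Let $e,m\in\mathbb R$ and $c,\hbar>0$ be constants and let $A=(A_0,A_1,A_2,A_3):\mathbb R^4\to\mathbb R^4$ be an external potential. Let $\mathcal P$ be the set of all $\lambda=(y,\vec\alpha,\vec\varphi)$ with $y=(y^0,\vec y)\in\mathbb R\times\mathbb R^3$, $\vec\alpha,\vec\varphi\in\mathbb R^3$, $|\vec\alpha|<1$ and $|\vec\varphi|<\pi$. Let $R_{\vec\varphi}\in SO(3)$ be the right-handed rotation by the angle $|\vec\varphi|$ around $\vec\varphi/|\vec\varphi|$ (the identity if $\vec\varphi=0$). For $\lambda\in\mathcal P$ put $$\sigma_\lambda(\vec u)=\bigl(y^0+\vec\alpha\cdot R_{\vec\varphi}\vec u,\ \vec y+R_{\vec\varphi}\vec u\bigr)\quad(\vec u\in\mathbb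 R^3),\qquad \|f\|_\lambda=\Bigl(\int_{\mathbb R^3} f^{+}(\vec u)\bigl(1-\gamma^0\,\vec\gamma\cdot\vec\alpha\bigr)f(\vec u)\,d\vec u\Bigr)^{1/2}\in[0,\infty]$$ for measurable $f:\mathbb R^3\to\mathbb C^4$, where $f^+$ is the conjugate transpose of $f$ (the integrand is real and nonnegative). Let $\hat H$ be the set of all continuously differentiable functions $\Psi:\mathbb R\times\mathbb R^3\to\mathbb C^4$ that satisfy $$\Bigl(i\gamma^\mu\partial_\mu-\frac{e}{c\hbar}\gamma^\mu A_\mu-\frac{mc}{\hbar}\Bigr)\Psi(x)=0\quad\text{for all }x\in\mathbb R\times\mathbb R^3$$ and, for every $\lambda\in\mathcal P$, $\|\Psi\circ\sigma_\lambda\|_\lambda<\infty$ and $\lim_{|\vec u|\to\infty}|\vec u|^3\,|\Psi(\sigma_\lambda(\vec u))|^2=0$. Theorem. Let $\mu\in\mathcal P$ be arbitrary and let $\Psi_1,\Psi_2\in\hat H$ satisfy $\Psi_1\circ\sigma_\mu=\Psi_2\circ\sigma_\mu$. Then $\Psi_1=\Psi_2$. -/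

import Mathlib

open scoped Matrix
open MeasureTheory Filter Topology

namespace DiracHyperplane

/-- Three-dimensional Euclidean space. -/
abbrev Space : Type := EuclideanSpace ℝ (Fin 3)

/-- Spacetime `ℝ × ℝ³`; a point is `(x⁰, x)`, where `x⁰` is `c` times the time. -/
abbrev Spacetime : Type := ℝ × Space

/-- The spinor space `ℂ⁴`, with its Hermitian norm. -/
abbrev Spinor : Type := EuclideanSpace ℂ (Fin 4)

/-- The Minkowski metric `diag(1, -1, -1, -1)`. -/
def minkowski (μ ν : Fin 4) : ℂ :=
  if μ = ν then (if μ = 0 then 1 else -1) else 0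

/-- `γ⁰, γ¹, γ², γ³` are Dirac matrices (in an arbitrary representation): complex `4 × 4` matrices
with `γ^μ γ^ν + γ^ν γ^μ = 2 g^{μν}`, where `γ⁰` is Hermitian and `γ¹, γ², γ³` are anti-Hermitian. -/
structure IsDiracMatrices (γ : Fin 4 → Matrix (Fin 4) (Fin 4) ℂ) : Prop where
  anticomm : ∀ μ ν, γ μ * γ ν + γ ν * γ μ = (2 * minkowski μ ν) • (1 : Matrix (Fin 4) (Fin 4) ℂ)
  hermitian_time : (γ 0)ᴴ = γ 0
  antihermitian_space : ∀ k : Fin 3, (γ k.succ)ᴴ = -γ k.succ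

/-- The cross product on Euclidean three-space. -/
noncomputable def cross (a b : Space) : Space :=
  WithLp.toLp 2 (crossProduct (WithLp.ofLp a) (WithLp.ofLp b))

/-- The rotation by the angle `|φ|` around the axis `φ / |φ|` in the right-handed sense (Rodrigues'
formula). For `φ = 0` the axis below is `0` and the map is the identity. -/
noncomputable def axisRotation (φ u : Space) : Space :=
  let n : Space := ‖φ‖⁻¹ • φ
  Real.cos ‖φ‖ • u + Real.sin ‖φ‖ • cross n u + ((1 - Real.cos ‖φ‖) * inner ℝ n u) • n

/-- The parameter set of the spacelike hyperplanes: `(y, α, φ)` with `|α| < 1` and `|φ| < π`. -/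
structure HyperplaneParam where
  y : Spacetime
  α : Space
  φ : Space
  norm_α_lt : ‖α‖ < 1
  norm_φ_lt : ‖φ‖ < Real.pi

/-- The parametrized hyperplane `σ_l(u) = (y⁰ + α · R_φ u, y + R_φ u)`. -/
noncomputable def hyperplane (l : HyperplaneParam) (u : Space) : Spacetime :=
  (l.y.1 + inner ℝ l.α (axisRotation l.φ u), l.y.2 + axisRotation l.φ u)

/-- The density `f⁺ (1 - γ⁰ γ⃗ · α) g` of the scalar product attached to a hyperplane with
slope `α`. -/
noncomputable def density (γ : Fin 4 → Matrix (Fin 4) (Fin 4) ℂ) (α : Space) (f g : Spinor) : ℂ :=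
  star (WithLp.ofLp f) ⬝ᵥ
    ((1 - ∑ k : Fin 3, (α k : ℂ) • (γ 0 * γ k.succ)) *ᵥ WithLp.ofLp g)

/-- The norm `‖f‖_l = (∫ f⁺ (1 - γ⁰ γ⃗ · α) f du)^{1/2}`, with value `∞` when the integral diverges.
The integrand is real and nonnegative, since the matrix is Hermitian with eigenvalues
`1 ± |α| > 0`. -/
noncomputable def hyperplaneNorm (γ : Fin 4 → Matrix (Fin 4) (Fin 4) ℂ) (l : HyperplaneParam)
    (f : Space → Spinor) : ENNReal :=
  (∫⁻ u, ENNReal.ofReal (density γ l.α (f u) (f u)).re) ^ (1 / 2 : ℝ)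

/-- The coordinate vectors of spacetime. -/
noncomputable def coordVec : Fin 4 → Spacetime :=
  Fin.cons (1, 0) fun k => (0, EuclideanSpace.single k 1)

/-- The partial derivative `∂_μ Ψ (x)`. -/
noncomputable def partialDeriv (μ : Fin 4) (Ψ : Spacetime → Spinor) (x : Spacetime) : Spinor :=
  fderiv ℝ Ψ x (coordVec μ)

/-- The Dirac operator `i γ^μ ∂_μ - (e / (c ħ)) γ^μ A_μ - m c / ħ` applied to `Ψ`, at `x`. -/
noncomputable def diracOp (γ : Fin 4 → Matrix (Fin 4) (Fin 4) ℂ) (e c ħ m : ℝ)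
    (A : Spacetime → Fin 4 → ℝ) (Ψ : Spacetime → Spinor) (x : Spacetime) : Fin 4 → ℂ :=
  Complex.I • (∑ μ, γ μ *ᵥ WithLp.ofLp (partialDeriv μ Ψ x))
    - ((e / (c * ħ) : ℝ) : ℂ) • (∑ μ, (A x μ : ℂ) • (γ μ *ᵥ WithLp.ofLp (Ψ x)))
    - ((m * c / ħ : ℝ) : ℂ) • WithLp.ofLp (Ψ x)

/-- Membership in the solution space: continuously differentiable solutions of the Dirac equation
with external potential `A` that have finite norm on every hyperplane and satisfy
`|u|³ |Ψ(σ_l(u))|² → 0` as `|u| → ∞` on every hyperplane. -/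
structure IsState (γ : Fin 4 → Matrix (Fin 4) (Fin 4) ℂ) (e c ħ m : ℝ)
    (A : Spacetime → Fin 4 → ℝ) (Ψ : Spacetime → Spinor) : Prop where
  contDiff : ContDiff ℝ 1 Ψ
  dirac : ∀ x, diracOp γ e c ħ m A Ψ x = 0
  norm_lt_top : ∀ l : HyperplaneParam, hyperplaneNorm γ l (Ψ ∘ hyperplane l) < ⊤
  decay : ∀ l : HyperplaneParam,
    Tendsto (fun u : Space => ‖u‖ ^ 3 * ‖Ψ (hyperplane l u)‖ ^ 2) (cocompact Space) (𝓝 0)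

/-- The solution space. -/
def stateSpace (γ : Fin 4 → Matrix (Fin 4) (Fin 4) ℂ) (e c ħ m : ℝ)
    (A : Spacetime → Fin 4 → ℝ) : Set (Spacetime → Spinor) :=
  {Ψ | IsState γ e c ħ m A Ψ}

end DiracHyperplane

/-! ### Rotations and points of a hyperplane -/

namespace DiracHyperplane

/-! By linearity, let `Ψ` be a solution vanishing on one hyperplane. Its current `j` is
divergence-free (`sum_fderiv_current_eq_zero`) and causal (`abs_sum_mul_current_le`) with `j⁰ =
|Ψ|²`; being quadratic in `Ψ`, it vanishes there together with its derivative. Each point off the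
hyperplane lies in a bounded cap between the hyperplane and a spacelike hyperboloid `phase = R`. The
field `(R - phase)² j` vanishes to first order on the cap's frontier, so its extension by zero is
`C¹` with compact support and its divergence integrates to zero. Up to sign, this divergence is at
least a positive multiple of `j⁰` in the cap, so `j⁰ = 0` there (`density_eq_zero_of_causal`). -/

theorem axisRotation_neg_right_inverse (φ u : Space) :
    axisRotation φ (axisRotation (-φ) u) = u := by
  by_cases hφ : φ = 0
  · simp [axisRotation, hφ]
  have hn : ‖‖φ‖⁻¹ • φ‖ = 1 := by
    rw [norm_smul, norm_inv, norm_norm, inv_mul_cancel₀ (norm_ne_zero_iff.2 hφ)]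
  simp only [axisRotation, norm_neg, smul_neg]
  generalize ‖φ‖⁻¹ • φ = n at hn
  have hcs := Real.sin_sq_add_cos_sq ‖φ‖
  generalize Real.cos ‖φ‖ = c at *
  generalize Real.sin ‖φ‖ = s at *
  have h1 : n 0 ^ 2 + n 1 ^ 2 + n 2 ^ 2 = 1 := by
    have := EuclideanSpace.real_norm_sq_eq n
    rw [hn, Fin.sum_univ_three] at this
    linarith
  ext i
  fin_cases i <;>
    simp [cross, crossProduct, Fin.sum_univ_three, PiLp.inner_apply, Matrix.vecHead,
      Matrix.vecTail]
  -- The `s ^ 2` term comes from `n × (n × u) = (n·u) n - |n|² u`, the `(1 - c) ^ 2` term from the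
  -- factor `|n|²` produced by composing the axis projections.
  · linear_combination (s ^ 2 * u 0 + (1 - c) ^ 2 * (n 0 * u 0 + n 1 * u 1 + n 2 * u 2) * n 0) * h1
      + (u 0 - (n 0 * u 0 + n 1 * u 1 + n 2 * u 2) * n 0) * hcs
  · linear_combination (s ^ 2 * u 1 + (1 - c) ^ 2 * (n 0 * u 0 + n 1 * u 1 + n 2 * u 2) * n 1) * h1
      + (u 1 - (n 0 * u 0 + n 1 * u 1 + n 2 * u 2) * n 1) * hcs
  · linear_combination (s ^ 2 * u 2 + (1 - c) ^ 2 * (n 0 * u 0 + n 1 * u 1 + n 2 * u 2) * n 2) * h1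
      + (u 2 - (n 0 * u 0 + n 1 * u 1 + n 2 * u 2) * n 2) * hcs

theorem axisRotation_surjective (φ : Space) : Function.Surjective (axisRotation φ) :=
  fun u => ⟨_, axisRotation_neg_right_inverse φ u⟩

/-- The affine time coordinate vanishing on the hyperplane. -/
noncomputable def height (l : HyperplaneParam) (x : Spacetime) : ℝ :=
  x.1 - l.y.1 - inner ℝ l.α (x.2 - l.y.2)

theorem exists_hyperplane_eq_of_height_eq_zero (l : HyperplaneParam) (x : Spacetime)
    (hx : height l x = 0) : ∃ u, hyperplane l u = x := by
  obtain ⟨u, hu⟩ := axisRotation_surjective l.φ (x.2 - l.y.2)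
  refine ⟨u, Prod.ext ?_ ?_⟩
  · simp only [hyperplane, hu]
    unfold height at hx
    linarith
  · simp [hyperplane, hu]

theorem continuous_height (l : HyperplaneParam) : Continuous (height l) := by
  unfold height
  fun_prop

/-! ### Extension by zero and vanishing integrals of derivatives -/

section Calculus

variable {E : Type*} [NormedAddCommGroup E] [NormedSpace ℝ E]

/-- At a frontier point `f y = o(|y - x|)`, and cutting off only decreases `|f|`. -/
theorem hasFDerivAt_indicator_of_frontier {f : E → ℝ} {f' : E → E →L[ℝ] ℝ} {s : Set E}
    (hs : IsOpen s) (hf : ∀ x, HasFDerivAt f (f' x) x)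
    (h0 : ∀ x ∈ frontier s, f x = 0) (h1 : ∀ x ∈ frontier s, f' x = 0) (x : E) :
    HasFDerivAt (s.indicator f) (s.indicator f' x) x := by
  by_cases hx : x ∈ s
  · rw [Set.indicator_of_mem hx]
    refine (hf x).congr_of_eventuallyEq ?_
    filter_upwards [hs.mem_nhds hx] with y hy using Set.indicator_of_mem hy f
  rw [Set.indicator_of_notMem hx]
  by_cases hc : x ∈ closure s
  · have hfr : x ∈ frontier s := by rw [hs.frontier_eq]; exact ⟨hc, hx⟩
    have h := hf x
    rw [h1 x hfr] at h
    rw [hasFDerivAt_iff_isLittleO] at h ⊢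
    refine (Asymptotics.isBigO_of_le _ fun y => ?_).trans_isLittleO h
    simp only [Set.indicator_of_notMem hx, h0 x hfr, sub_zero, zero_apply]
    exact norm_indicator_le_norm_self f y
  · refine (hasFDerivAt_const (0 : ℝ) x).congr_of_eventuallyEq ?_
    filter_upwards [isClosed_closure.isOpen_compl.mem_nhds hc] with y hy
    exact Set.indicator_of_notMem (fun h => hy (subset_closure h)) f

variable [FiniteDimensional ℝ E] [MeasurableSpace E] [BorelSpace E]

/-- Integration by parts against the constant function `1`. -/
theorem integral_deriv_eq_zero_of_hasCompactSupport (μ : Measure E) [μ.IsAddHaarMeasure]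
    {f : E → ℝ} {f' : E → E →L[ℝ] ℝ} (hf : ∀ x, HasFDerivAt f (f' x) x) (hf' : Continuous f')
    (hc : HasCompactSupport f) (hc' : HasCompactSupport f') (v : E) :
    ∫ x, f' x v ∂μ = 0 := by
  have hint : Integrable (fun x => f' x v) μ := by
    refine Continuous.integrable_of_hasCompactSupport (by fun_prop) (hc'.mono fun x hx h => hx ?_)
    simp [show f' x = 0 from h]
  have hint' : Integrable f μ := Continuous.integrable_of_hasCompactSupport
    (continuous_iff_continuousAt.2 fun x => (hf x).continuousAt) hc
  simpa using integral_bilinear_hasFDerivAt_right_eq_neg_left_of_integrable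
    (μ := μ) (f := fun _ : E => (1 : ℝ)) (f' := fun _ => 0) (g := f) (g' := f') (v := v)
    (B := ContinuousLinearMap.mul ℝ ℝ) (by simp) (by simpa using hint) (by simpa using hint')
    (fun x _ => hasFDerivAt_const _ _) (fun x _ => hf x)

end Calculus

/-! ### The Dirac current: causality and conservation -/

section Current

variable {γ : Fin 4 → Matrix (Fin 4) (Fin 4) ℂ}

/-- The operator `γ⁰ γ^μ` on spinors. -/
noncomputable def velocity (γ : Fin 4 → Matrix (Fin 4) (Fin 4) ℂ) (μ : Fin 4) :
    Spinor →L[ℂ] Spinor :=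
  Matrix.toEuclideanCLM (𝕜 := ℂ) (γ 0 * γ μ)

theorem IsDiracMatrices.time_mul_time (hγ : IsDiracMatrices γ) : γ 0 * γ 0 = 1 := by
  have h := hγ.anticomm 0 0
  rw [← two_smul ℂ, ← smul_smul] at h
  simpa [minkowski] using smul_right_injective _ (two_ne_zero (α := ℂ)) h

theorem IsDiracMatrices.time_mul_space (hγ : IsDiracMatrices γ) (k : Fin 3) :
    γ k.succ * γ 0 = -(γ 0 * γ k.succ) := by
  have h := hγ.anticomm k.succ 0
  rw [minkowski, if_neg (Fin.succ_ne_zero k)] at h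
  simpa using eq_neg_of_add_eq_zero_left (by simpa using h)

theorem velocity_zero (hγ : IsDiracMatrices γ) : velocity γ 0 = 1 := by
  rw [velocity, hγ.time_mul_time, map_one]

theorem isSelfAdjoint_velocity (hγ : IsDiracMatrices γ) (μ : Fin 4) :
    IsSelfAdjoint (velocity γ μ) := by
  refine IsSelfAdjoint.map (f := Matrix.toEuclideanCLM (n := Fin 4) (𝕜 := ℂ)) ?_
  rw [IsSelfAdjoint, Matrix.star_eq_conjTranspose, Matrix.conjTranspose_mul, hγ.hermitian_time]
  induction μ using Fin.cases with
  | zero => rw [hγ.hermitian_time]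
  | succ k => rw [hγ.antihermitian_space, neg_mul, hγ.time_mul_space, neg_neg]

theorem velocity_anticomm (hγ : IsDiracMatrices γ) (j k : Fin 3) :
    velocity γ j.succ * velocity γ k.succ + velocity γ k.succ * velocity γ j.succ =
      (if j = k then (2 : ℂ) else 0) • 1 := by
  have key : ∀ j k : Fin 3, γ 0 * γ j.succ * (γ 0 * γ k.succ) = -(γ j.succ * γ k.succ) := by
    intro j k
    rw [Matrix.mul_assoc, ← Matrix.mul_assoc (γ j.succ), hγ.time_mul_space, Matrix.neg_mul,
      Matrix.mul_neg, Matrix.mul_assoc, ← Matrix.mul_assoc, hγ.time_mul_time, Matrix.one_mul]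
  simp only [velocity]
  rw [← map_mul, ← map_mul, ← map_add, key, key, ← neg_add, hγ.anticomm]
  by_cases h : j = k
  · subst h
    have h2 : -((2 * minkowski j.succ j.succ) • (1 : Matrix (Fin 4) (Fin 4) ℂ)) = (2 : ℂ) • 1 := by
      simp [minkowski, Fin.succ_ne_zero]
    rw [h2, map_smul, map_one, if_pos rfl]
  · simp only [minkowski, Fin.succ_inj, h, if_false, mul_zero, zero_smul, neg_zero, map_zero]
    exact (zero_smul ℂ (1 : Spinor →L[ℂ] Spinor)).symm

/-- The component `Ψ⁺ γ⁰ γ^μ Ψ` of the probability current. -/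
noncomputable def current (γ : Fin 4 → Matrix (Fin 4) (Fin 4) ℂ) (μ : Fin 4) (f : Spinor) : ℝ :=
  (inner ℂ f (velocity γ μ f)).re

theorem current_zero (hγ : IsDiracMatrices γ) (f : Spinor) : current γ 0 f = ‖f‖ ^ 2 := by
  rw [current, velocity_zero hγ, one_apply_eq_self, inner_self_eq_norm_sq_to_K]
  norm_cast

theorem sum_smul_velocity_sq (hγ : IsDiracMatrices γ) (v : Space) :
    (∑ k, (v k : ℂ) • velocity γ (Fin.succ k)) * (∑ k, (v k : ℂ) • velocity γ (Fin.succ k)) =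
      ((‖v‖ ^ 2 : ℝ) : ℂ) • 1 := by
  have hsq : ∀ k, velocity γ (Fin.succ k) * velocity γ (Fin.succ k) = 1 := fun k => by
    have h := velocity_anticomm hγ k k
    rw [if_pos rfl, ← two_smul ℂ] at h
    exact smul_right_injective _ (two_ne_zero (α := ℂ)) h
  have hne : ∀ j k : Fin 3, j ≠ k → velocity γ j.succ * velocity γ k.succ =
      -(velocity γ k.succ * velocity γ j.succ) := fun j k hjk => by
    have h := velocity_anticomm hγ j k
    rw [if_neg hjk] at h
    exact eq_neg_of_add_eq_zero_left (h.trans (zero_smul ℂ (1 : Spinor →L[ℂ] Spinor)))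
  rw [EuclideanSpace.real_norm_sq_eq]
  simp only [Fin.sum_univ_three, add_mul, mul_add, smul_mul_smul_comm, hsq]
  rw [hne 1 0 (by decide), hne 2 0 (by decide), hne 2 1 (by decide)]
  push_cast
  module

/-- The matrix `M = v · γ⁰γ⃗` is self-adjoint with `M² = |v|²`, so `‖M f‖ = ‖v‖ ‖f‖`, and
Cauchy–Schwarz applies. This is causality of the current. -/
theorem abs_sum_mul_current_le (hγ : IsDiracMatrices γ) (v : Space) (f : Spinor) :
    |∑ k, v k * current γ (Fin.succ k) f| ≤ ‖v‖ * ‖f‖ ^ 2 := by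
  set M := ∑ k, (v k : ℂ) • velocity γ (Fin.succ k) with hM
  have hsa : IsSelfAdjoint M := by
    refine isSelfAdjoint_sum (R := Spinor →L[ℂ] Spinor) _ fun k _ => ?_
    exact IsSelfAdjoint.smul (Complex.conj_ofReal _) (isSelfAdjoint_velocity hγ _)
  have hsum : ∑ k, v k * current γ (Fin.succ k) f = (inner ℂ f (M f)).re := by
    simp [hM, current]
  have hnorm : ‖M f‖ = ‖v‖ * ‖f‖ := by
    have h1 : inner ℂ (M f) (M f) = ((‖v‖ ^ 2 : ℝ) : ℂ) * inner ℂ f f := by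
      rw [← inner_smul_right, ← ContinuousLinearMap.adjoint_inner_right,
        ← ContinuousLinearMap.star_eq_adjoint, hsa.star_eq]
      have h2 := congrArg (fun T : Spinor →L[ℂ] Spinor => T f) (sum_smul_velocity_sq hγ v)
      exact congrArg (inner ℂ f) h2
    rw [inner_self_eq_norm_sq_to_K, inner_self_eq_norm_sq_to_K] at h1
    have h2 : ‖M f‖ ^ 2 = (‖v‖ * ‖f‖) ^ 2 := by
      rw [mul_pow]
      apply Complex.ofReal_injective
      push_cast at h1 ⊢
      exact h1
    exact (pow_left_inj₀ (norm_nonneg _) (by positivity) two_ne_zero).1 h2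
  rw [hsum]
  calc _ ≤ ‖inner ℂ f (M f)‖ := Complex.abs_re_le_norm _
    _ ≤ ‖f‖ * ‖M f‖ := norm_inner_le_norm _ _
    _ = _ := by rw [hnorm]; ring

/-- The derivative of the current density of a spinor field. -/
theorem hasFDerivAt_current (hγ : IsDiracMatrices γ) {Ψ : Spacetime → Spinor}
    {Ψ' : Spacetime →L[ℝ] Spinor} {x : Spacetime} (h : HasFDerivAt Ψ Ψ' x) (μ : Fin 4) :
    HasFDerivAt (fun y => current γ μ (Ψ y))
      ((2 : ℝ) • (Complex.reCLM ∘L ((innerSL ℂ (velocity γ μ (Ψ x))).restrictScalars ℝ ∘L Ψ'))) x := by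
  have h1 := ((velocity γ μ).restrictScalars ℝ).hasFDerivAt.comp x h
  have h2 := Complex.reCLM.hasFDerivAt.comp x (h.inner ℂ h1)
  refine h2.congr_fderiv (ContinuousLinearMap.ext fun v => ?_)
  have h3 : inner ℂ (Ψ x) (velocity γ μ (Ψ' v)) = inner ℂ (velocity γ μ (Ψ x)) (Ψ' v) := by
    rw [← ContinuousLinearMap.adjoint_inner_left, ← ContinuousLinearMap.star_eq_adjoint,
      (isSelfAdjoint_velocity hγ μ).star_eq]
  have h4 : (inner ℂ (Ψ' v) (velocity γ μ (Ψ x))).re = (inner ℂ (velocity γ μ (Ψ x)) (Ψ' v)).re :=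
    inner_re_symm (𝕜 := ℂ) (Ψ' v) (velocity γ μ (Ψ x))
  simp [fderivInnerCLM_apply, h3, h4, two_mul]

/-- Multiplying the Dirac equation by `-i γ⁰` puts it in Hamiltonian form, with potential and mass
gathered in one operator. -/
theorem sum_velocity_partialDeriv {e c ħ m : ℝ}
    {A : Spacetime → Fin 4 → ℝ} {Ψ : Spacetime → Spinor} {x : Spacetime}
    (h : diracOp γ e c ħ m A Ψ x = 0) :
    ∑ μ, velocity γ μ (partialDeriv μ Ψ x) =
      -Complex.I • (((e / (c * ħ) : ℝ) : ℂ) • ∑ μ, (A x μ : ℂ) • velocity γ μ +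
        ((m * c / ħ : ℝ) : ℂ) • Matrix.toEuclideanCLM (𝕜 := ℂ) (γ 0)) (Ψ x) := by
  have h1 := congrArg (fun w => -Complex.I • (γ 0 *ᵥ w)) h
  simp only [diracOp, Matrix.mulVec_sub, Matrix.mulVec_smul, Matrix.mulVec_sum,
    Matrix.mulVec_mulVec, Matrix.mulVec_zero, smul_zero, smul_sub, smul_smul] at h1
  apply WithLp.ofLp_injective 2
  have h2 : ∀ μ (f : Spinor), WithLp.ofLp (velocity γ μ f) = (γ 0 * γ μ) *ᵥ WithLp.ofLp f :=
    fun _ _ => rfl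
  have h3 : ∀ f : Spinor, WithLp.ofLp (Matrix.toEuclideanCLM (𝕜 := ℂ) (γ 0) f) =
    γ 0 *ᵥ WithLp.ofLp f := fun _ => rfl
  rw [neg_mul, Complex.I_mul_I, neg_neg, one_smul, sub_sub, sub_eq_zero] at h1
  simp only [WithLp.ofLp_sum, h2, h1]
  simp [h2, h3, smul_smul]

/-- The divergence is `2 Re ⟨Ψ, -i K Ψ⟩`, and `⟨Ψ, K Ψ⟩` is real because `K` is self-adjoint, the
potential and constants being real. -/
theorem sum_fderiv_current_eq_zero (hγ : IsDiracMatrices γ) {e c ħ m : ℝ}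
    {A : Spacetime → Fin 4 → ℝ} {Ψ : Spacetime → Spinor} {x : Spacetime}
    (hd : DifferentiableAt ℝ Ψ x) (h : diracOp γ e c ħ m A Ψ x = 0) :
    ∑ μ, fderiv ℝ (fun y => current γ μ (Ψ y)) x (coordVec μ) = 0 := by
  set K := ((e / (c * ħ) : ℝ) : ℂ) • ∑ μ, (A x μ : ℂ) • velocity γ μ +
    ((m * c / ħ : ℝ) : ℂ) • Matrix.toEuclideanCLM (𝕜 := ℂ) (γ 0) with hK
  have hreal : ∀ r : ℝ, IsSelfAdjoint (r : ℂ) := fun r => Complex.conj_ofReal r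
  have hsa : IsSelfAdjoint K := by
    refine ((hreal _).smul (isSelfAdjoint_sum (R := Spinor →L[ℂ] Spinor) _ fun μ _ =>
      (hreal _).smul (isSelfAdjoint_velocity hγ μ))).add ((hreal _).smul ?_)
    exact IsSelfAdjoint.map (f := Matrix.toEuclideanCLM (n := Fin 4) (𝕜 := ℂ))
      (hγ.hermitian_time : star (γ 0) = γ 0)
  have h1 : ∀ μ, fderiv ℝ (fun y => current γ μ (Ψ y)) x (coordVec μ) =
      2 * (inner ℂ (Ψ x) (velocity γ μ (partialDeriv μ Ψ x))).re := fun μ => by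
    rw [(hasFDerivAt_current hγ hd.hasFDerivAt μ).fderiv, ← ContinuousLinearMap.adjoint_inner_left,
      ← ContinuousLinearMap.star_eq_adjoint, (isSelfAdjoint_velocity hγ μ).star_eq]
    simp [partialDeriv]
  have h2 : (inner ℂ (Ψ x) (K (Ψ x))).im = 0 := by
    rw [← Complex.conj_eq_iff_im, inner_conj_symm, ← ContinuousLinearMap.adjoint_inner_right,
      ← ContinuousLinearMap.star_eq_adjoint, hsa.star_eq]
  simp only [h1]
  rw [← Finset.mul_sum, ← Complex.re_sum, ← inner_sum, sum_velocity_partialDeriv h, ← hK,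
    inner_smul_right]
  simp [h2]

theorem contDiff_current {Ψ : Spacetime → Spinor}
    (h : ContDiff ℝ 1 Ψ) (μ : Fin 4) : ContDiff ℝ 1 fun y => current γ μ (Ψ y) := by
  have h1 : ContDiff ℝ 1 fun y => velocity γ μ (Ψ y) :=
    ((velocity γ μ).restrictScalars ℝ).contDiff.comp h
  exact Complex.reCLM.contDiff.comp (h.inner ℂ h1)

end Current

/-! ### Hyperboloids and the caps they cut off -/

section Hyperboloid

/-- The function `κ √(1 + |x|²) + ε x⁰`, whose level sets are spacelike for `κ < 1`. -/
noncomputable def phase (κ ε : ℝ) (x : Spacetime) : ℝ :=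
  κ * √(1 + ‖x.2‖ ^ 2) + ε * x.1

/-- The derivative of `phase`. -/
noncomputable def phaseDeriv (κ ε : ℝ) (x : Spacetime) : Spacetime →L[ℝ] ℝ :=
  (κ / √(1 + ‖x.2‖ ^ 2)) • (innerSL ℝ x.2 ∘L ContinuousLinearMap.snd ℝ ℝ Space) +
    ε • ContinuousLinearMap.fst ℝ ℝ Space

theorem hasFDerivAt_phase (κ ε : ℝ) (x : Spacetime) :
    HasFDerivAt (phase κ ε) (phaseDeriv κ ε x) x := by
  have hpos : 0 < 1 + ‖x.2‖ ^ 2 := by positivity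
  have h1 : HasFDerivAt (fun y : Spacetime => ‖y.2‖ ^ 2)
      (2 • (innerSL ℝ x.2 ∘L ContinuousLinearMap.snd ℝ ℝ Space)) x :=
    (hasFDerivAt_snd (𝕜 := ℝ) (p := x)).norm_sq
  have h2 := ((((h1.const_add 1).sqrt hpos.ne').const_mul κ).add
    ((hasFDerivAt_fst (𝕜 := ℝ) (p := x)).const_mul ε))
  refine h2.congr_fderiv ?_
  have hr : √(1 + ‖x.2‖ ^ 2) ≠ 0 := (Real.sqrt_pos.2 hpos).ne'
  rw [phaseDeriv, ← Nat.cast_smul_eq_nsmul ℝ, smul_smul, smul_smul]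
  congr 2
  field_simp
  norm_num

theorem continuous_phase (κ ε : ℝ) : Continuous (phase κ ε) := by
  unfold phase
  fun_prop

theorem continuous_phaseDeriv (κ ε : ℝ) : Continuous (phaseDeriv κ ε) := by
  have hr : ∀ x : Spacetime, √(1 + ‖x.2‖ ^ 2) ≠ 0 := fun x => by positivity
  unfold phaseDeriv
  refine Continuous.add (Continuous.smul
    (continuous_const.div (by fun_prop) hr) ?_) continuous_const
  exact ((innerSL ℝ).continuous.comp continuous_snd).clm_comp continuous_const

theorem phaseDeriv_coordVec_zero (κ ε : ℝ) (x : Spacetime) :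
    phaseDeriv κ ε x (coordVec 0) = ε := by
  simp [phaseDeriv, coordVec]

theorem phaseDeriv_coordVec_succ (κ ε : ℝ) (x : Spacetime) (k : Fin 3) :
    phaseDeriv κ ε x (coordVec k.succ) = κ / √(1 + ‖x.2‖ ^ 2) * x.2 k := by
  simp [phaseDeriv, coordVec, EuclideanSpace.inner_single_right]

/-- The part of the sublevel set of `phase` that lies on one side of a hyperplane. -/
def cap (l : HyperplaneParam) (κ ε R : ℝ) : Set Spacetime :=
  {x | 0 < ε * height l x} ∩ {x | phase κ ε x < R}

theorem isOpen_cap (l : HyperplaneParam) (κ ε R : ℝ) : IsOpen (cap l κ ε R) :=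
  (isOpen_lt continuous_const ((continuous_height l).const_mul ε)).inter
    (isOpen_lt (continuous_phase κ ε) continuous_const)

theorem frontier_cap_subset (l : HyperplaneParam) (κ ε R : ℝ) {x : Spacetime}
    (hx : x ∈ frontier (cap l κ ε R)) : ε * height l x = 0 ∨ phase κ ε x = R := by
  rcases frontier_inter_subset _ _ hx with h | h
  · exact .inl (frontier_lt_subset_eq continuous_const ((continuous_height l).const_mul ε) h.1).symm
  · exact .inr (frontier_lt_subset_eq (continuous_phase κ ε) continuous_const h.2)

/-- The hyperboloid has asymptotic slope `κ`, steeper than the hyperplane's `|α|`, so the two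
surfaces eventually cross. Adding the two inequalities of the cap gives `(κ - |α|) |x| < D`. -/
theorem isBounded_cap (l : HyperplaneParam) {κ ε : ℝ} (hκ : ‖l.α‖ < κ) (hε : |ε| = 1) (R : ℝ) :
    Bornology.IsBounded (cap l κ ε R) := by
  set D := |R| + |l.y.1| + ‖l.α‖ * ‖l.y.2‖ with hD
  have hD0 : 0 ≤ D := by positivity
  have hd : 0 < κ - ‖l.α‖ := sub_pos.2 hκ
  have hκ0 : 0 < κ := (norm_nonneg _).trans_lt hκ
  refine isBounded_iff_forall_norm_le.2 ⟨D + D / (κ - ‖l.α‖), fun x hx => ?_⟩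
  obtain ⟨h1, h2⟩ : 0 < ε * height l x ∧ phase κ ε x < R := hx
  have hsq : ‖x.2‖ ≤ √(1 + ‖x.2‖ ^ 2) := Real.le_sqrt_of_sq_le (by linarith)
  have h3 : κ * ‖x.2‖ + ε * x.1 < R :=
    (add_le_add_left (mul_le_mul_of_nonneg_left hsq hκ0.le) _).trans_lt h2
  have h4 : |ε * l.y.1| = |l.y.1| := by rw [abs_mul, hε, one_mul]
  have h5 : |ε * inner ℝ l.α (x.2 - l.y.2)| ≤ ‖l.α‖ * (‖x.2‖ + ‖l.y.2‖) := by
    rw [abs_mul, hε, one_mul]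
    exact (abs_real_inner_le_norm _ _).trans
      (mul_le_mul_of_nonneg_left (norm_sub_le _ _) (norm_nonneg _))
  have h6 : |x.1| = |ε * x.1| := by rw [abs_mul, hε, one_mul]
  rw [height, mul_sub, mul_sub] at h1
  have h7 := abs_le.1 h4.le
  have h8 := abs_le.1 h5
  have h9 := le_abs_self R
  have h10 : ‖x.2‖ ≤ D / (κ - ‖l.α‖) := by
    rw [le_div_iff₀ hd]
    nlinarith
  have h11 : ‖l.α‖ * ‖x.2‖ ≤ ‖x.2‖ := mul_le_of_le_one_left (norm_nonneg _) l.norm_α_lt.le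
  have h12 : 0 ≤ κ * ‖x.2‖ := by positivity
  have h13 : 0 ≤ ‖l.α‖ * ‖l.y.2‖ := by positivity
  have h14 := abs_nonneg l.y.1
  refine max_le ?_ (by linarith)
  rw [Real.norm_eq_abs, h6, abs_le]
  constructor <;> nlinarith [abs_nonneg R, norm_nonneg x.2]

end Hyperboloid

/-! ### The energy argument and uniqueness -/

theorem density_eq_zero_of_causal {j : Fin 4 → Spacetime → ℝ}
    (hj : ∀ μ, ContDiff ℝ 1 (j μ))
    (hdiv : ∀ x, ∑ μ, fderiv ℝ (j μ) x (coordVec μ) = 0)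
    (hpos : ∀ x, 0 ≤ j 0 x)
    (hcausal : ∀ (x : Spacetime) (v : Space), |∑ k, v k * j (Fin.succ k) x| ≤ ‖v‖ * j 0 x)
    (l : HyperplaneParam)
    (hzero : ∀ x, height l x = 0 → ∀ μ, j μ x = 0 ∧ fderiv ℝ (j μ) x = 0)
    {ε : ℝ} (hε : |ε| = 1) {p : Spacetime} (hp : 0 < ε * height l p) : j 0 p = 0 := by
  have hε0 : ε ≠ 0 := by rintro rfl; simp at hε
  have hεε : ε * ε = 1 := by rw [← abs_mul_abs_self, hε, one_mul]
  -- `|α| < κ` bounds the cap; `κ < 1` keeps the hyperboloid spacelike, giving the factor `1 - κ >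
  -- 0` in `hlow`.
  obtain ⟨κ, hκ, hκ1⟩ := exists_between l.norm_α_lt
  have hκ0 : 0 < κ := (norm_nonneg _).trans_lt hκ
  have : (volume : Measure Spacetime).IsAddHaarMeasure :=
    inferInstanceAs ((volume : Measure ℝ).prod (volume : Measure Space)).IsAddHaarMeasure
  set R := phase κ ε p + 1 with hR
  set S := cap l κ ε R with hS
  -- The square makes the weight vanish to first order on the hyperboloid; on the hyperplane `j`
  -- itself does.
  let F : Fin 4 → Spacetime → ℝ := fun μ x => (R - phase κ ε x) ^ 2 * j μ x
  let F' : Fin 4 → Spacetime → Spacetime →L[ℝ] ℝ := fun μ x =>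
    (R - phase κ ε x) ^ 2 • fderiv ℝ (j μ) x +
      (j μ x) • ((-(2 * (R - phase κ ε x))) • phaseDeriv κ ε x)
  have hF : ∀ μ x, HasFDerivAt (F μ) (F' μ x) x := fun μ x => by
    refine ((((hasFDerivAt_phase κ ε x).const_sub R).pow 2).mul
      (((hj μ).differentiable one_ne_zero) x).hasFDerivAt).congr_fderiv ?_
    ext v <;> simp [F']
  have hF'c : ∀ μ, Continuous (F' μ) := fun μ => by
    have h1 := (hj μ).continuous
    have h2 := (hj μ).continuous_fderiv one_ne_zero
    have h3 := continuous_phase κ ε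
    have h4 := continuous_phaseDeriv κ ε
    fun_prop
  have hfr : ∀ x ∈ frontier S, ∀ μ, F μ x = 0 ∧ F' μ x = 0 := fun x hx μ => by
    rcases frontier_cap_subset l κ ε R hx with h | h
    · obtain ⟨h1, h2⟩ := hzero x ((mul_eq_zero.1 h).resolve_left hε0) μ
      simp [F, F', h1, h2]
    · simp [F, F', h]
  have hcomp : IsCompact (closure S) := (isBounded_cap l hκ hε R).isCompact_closure
  have hsub : ∀ {M : Type} [Zero M] (f : Spacetime → M), HasCompactSupport (S.indicator f) :=
    fun f => HasCompactSupport.of_support_subset_isCompact hcomp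
      (Set.support_indicator_subset.trans subset_closure)
  have hcont : ∀ μ, Continuous (S.indicator (F' μ)) := fun μ =>
    (hF'c μ).indicator fun x hx => (hfr x hx μ).2
  have hint : ∀ μ, ∫ x, S.indicator (F' μ) x (coordVec μ) = 0 := fun μ =>
    integral_deriv_eq_zero_of_hasCompactSupport volume
      (hasFDerivAt_indicator_of_frontier (isOpen_cap l κ ε R) (hF μ)
        (fun x hx => (hfr x hx μ).1) fun x hx => (hfr x hx μ).2)
      (hcont μ) (hsub _) (hsub _) _
  have happ : ∀ μ x, S.indicator (F' μ) x (coordVec μ) =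
      S.indicator (fun y => F' μ y (coordVec μ)) x := fun μ x => by
    by_cases hx : x ∈ S <;> simp [hx]
  -- The factor `-ε` makes the divergence nonnegative on either side of the hyperplane.
  let g : Spacetime → ℝ := fun x => -ε * ∑ μ, F' μ x (coordVec μ)
  have hG : S.indicator g = fun x => -ε * ∑ μ, S.indicator (F' μ) x (coordVec μ) := by
    funext x
    by_cases hx : x ∈ S <;> simp [hx, g]
  have hGcont : Continuous (S.indicator g) := by
    rw [hG]
    fun_prop
  have hGint : ∫ x, S.indicator g x = 0 := by
    rw [hG, integral_const_mul, integral_finsetSum, Finset.sum_eq_zero fun μ _ => hint μ, mul_zero]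
    intro μ _
    refine Continuous.integrable_of_hasCompactSupport (by fun_prop) ?_
    simp only [happ]
    exact hsub _
  have hg : ∀ x, g x = 2 * (R - phase κ ε x) *
      (j 0 x + ε * (κ / √(1 + ‖x.2‖ ^ 2)) * ∑ k, x.2 k * j (Fin.succ k) x) := fun x => by
    have h1 : ∑ μ, F' μ x (coordVec μ) = -(2 * (R - phase κ ε x)) *
        ∑ μ, j μ x * phaseDeriv κ ε x (coordVec μ) := by
      simp only [F', add_apply, smul_apply, smul_eq_mul, Finset.sum_add_distrib,
        ← Finset.mul_sum, hdiv, mul_zero, zero_add]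
      rw [Finset.mul_sum]
      exact Finset.sum_congr rfl fun μ _ => by ring
    simp only [g, h1]
    simp only [Fin.sum_univ_succ (n := 3), phaseDeriv_coordVec_zero, phaseDeriv_coordVec_succ]
    have h2 : ∑ k : Fin 3, j k.succ x * (κ / √(1 + ‖x.2‖ ^ 2) * x.2 k) =
        κ / √(1 + ‖x.2‖ ^ 2) * ∑ k : Fin 3, x.2 k * j k.succ x := by
      rw [Finset.mul_sum]
      exact Finset.sum_congr rfl fun k _ => by ring
    rw [h2]
    linear_combination (2 * (R - phase κ ε x) * j 0 x) * hεε
  have hlow : ∀ x, (1 - κ) * j 0 x ≤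
      j 0 x + ε * (κ / √(1 + ‖x.2‖ ^ 2)) * ∑ k, x.2 k * j (Fin.succ k) x := fun x => by
    have hr : 0 < √(1 + ‖x.2‖ ^ 2) := by positivity
    have hsq : ‖x.2‖ ≤ √(1 + ‖x.2‖ ^ 2) := Real.le_sqrt_of_sq_le (by linarith)
    have h1 : |ε * (κ / √(1 + ‖x.2‖ ^ 2)) * ∑ k, x.2 k * j (Fin.succ k) x| ≤ κ * j 0 x := by
      rw [abs_mul, abs_mul, hε, one_mul, abs_of_nonneg (by positivity)]
      calc _ ≤ κ / √(1 + ‖x.2‖ ^ 2) * (‖x.2‖ * j 0 x) :=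
            mul_le_mul_of_nonneg_left (hcausal x x.2) (by positivity)
        _ ≤ κ / √(1 + ‖x.2‖ ^ 2) * (√(1 + ‖x.2‖ ^ 2) * j 0 x) :=
            mul_le_mul_of_nonneg_left (mul_le_mul_of_nonneg_right hsq (hpos x)) (by positivity)
        _ = κ * j 0 x := by field_simp
    linarith [(abs_le.1 h1).1]
  have hGnonneg : 0 ≤ S.indicator g := by
    refine Set.indicator_nonneg fun x hx => ?_
    rw [hg]
    have h1 : phase κ ε x < R := hx.2
    exact mul_nonneg (by linarith) ((mul_nonneg (by linarith) (hpos x)).trans (hlow x))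
  have hpS : p ∈ S := ⟨hp, show phase κ ε p < R by linarith⟩
  -- A continuous nonnegative function with zero integral vanishes; at `p` the weight `R - phase`
  -- equals `1`.
  have hgp : S.indicator g p = 0 := by
    by_contra hne
    exact (hGcont.integral_pos_of_hasCompactSupport_nonneg_nonzero (μ := volume) (hsub _)
      hGnonneg hne).ne' hGint
  rw [Set.indicator_of_mem hpS, hg, hR] at hgp
  have h1 := hlow p
  have h2 : (1 - κ) * j 0 p ≤ 0 := by linarith
  have h3 := hpos p
  nlinarith

theorem eq_zero_of_eq_zero_on_hyperplane {γ : Fin 4 → Matrix (Fin 4) (Fin 4) ℂ}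
    (hγ : IsDiracMatrices γ) {e c ħ m : ℝ} {A : Spacetime → Fin 4 → ℝ} {Ψ : Spacetime → Spinor}
    (hΨ : ContDiff ℝ 1 Ψ) (hd : ∀ x, diracOp γ e c ħ m A Ψ x = 0) (l : HyperplaneParam)
    (h0 : ∀ u, Ψ (hyperplane l u) = 0) : Ψ = 0 := by
  have hdiff := hΨ.differentiable one_ne_zero
  have hon : ∀ x, height l x = 0 → Ψ x = 0 := fun x hx => by
    obtain ⟨u, rfl⟩ := exists_hyperplane_eq_of_height_eq_zero l x hx
    exact h0 u
  have key : ∀ {ε : ℝ}, |ε| = 1 → ∀ {p}, 0 < ε * height l p → Ψ p = 0 := fun hε p hp => by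
    have h := density_eq_zero_of_causal (j := fun μ x => current γ μ (Ψ x))
      (fun μ => contDiff_current hΨ μ) (fun x => sum_fderiv_current_eq_zero hγ (hdiff x) (hd x))
      (fun x => by rw [current_zero hγ]; positivity)
      (fun x v => by rw [current_zero hγ]; exact abs_sum_mul_current_le hγ v (Ψ x)) l
      -- The derivative of the current is linear in `Ψ x` for a given `Ψ'`, so it vanishes with `Ψ
      -- x`.
      (fun x hx μ => ⟨by simp [current, hon x hx], by
        rw [(hasFDerivAt_current hγ (hdiff x).hasFDerivAt μ).fderiv, hon x hx]
        ext <;> simp⟩) hε hp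
    rw [current_zero hγ] at h
    simpa using h
  funext x
  rcases lt_trichotomy (height l x) 0 with h | h | h
  · exact key (ε := -1) (by simp) (by linarith)
  · exact hon x h
  · exact key (ε := 1) (by simp) (by linarith)

theorem diracOp_sub (γ : Fin 4 → Matrix (Fin 4) (Fin 4) ℂ) (e c ħ m : ℝ)
    (A : Spacetime → Fin 4 → ℝ) {Ψ₁ Ψ₂ : Spacetime → Spinor} {x : Spacetime}
    (h₁ : DifferentiableAt ℝ Ψ₁ x) (h₂ : DifferentiableAt ℝ Ψ₂ x) :
    diracOp γ e c ħ m A (Ψ₁ - Ψ₂) x = diracOp γ e c ħ m A Ψ₁ x - diracOp γ e c ħ m A Ψ₂ x := by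
  have hp : ∀ μ, partialDeriv μ (Ψ₁ - Ψ₂) x = partialDeriv μ Ψ₁ x - partialDeriv μ Ψ₂ x :=
    fun μ => by simp [partialDeriv, fderiv_sub h₁ h₂]
  simp only [diracOp, hp, Pi.sub_apply, WithLp.ofLp_sub, Matrix.mulVec_sub, smul_sub,
    Finset.sum_sub_distrib]
  abel

end DiracHyperplane

theorem theorem2 (γ : Fin 4 → Matrix (Fin 4) (Fin 4) ℂ)
    (hγ : DiracHyperplane.IsDiracMatrices γ)
    (e c ħ m : ℝ) (hc : 0 < c) (hħ : 0 < ħ)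
    (A : DiracHyperplane.Spacetime → Fin 4 → ℝ)
    (μ : DiracHyperplane.HyperplaneParam)
    (Ψ₁ Ψ₂ : DiracHyperplane.Spacetime → DiracHyperplane.Spinor)
    (h₁ : Ψ₁ ∈ DiracHyperplane.stateSpace γ e c ħ m A)
    (h₂ : Ψ₂ ∈ DiracHyperplane.stateSpace γ e c ħ m A)
    (h : Ψ₁ ∘ DiracHyperplane.hyperplane μ = Ψ₂ ∘ DiracHyperplane.hyperplane μ) :
    Ψ₁ = Ψ₂ := by
  refine sub_eq_zero.1 (DiracHyperplane.eq_zero_of_eq_zero_on_hyperplane hγ (e := e) (c := c)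
    (ħ := ħ) (m := m) (A := A) (h₁.contDiff.sub h₂.contDiff) (fun x => ?_) μ fun u => ?_)
  · rw [DiracHyperplane.diracOp_sub _ _ _ _ _ _ (h₁.contDiff.differentiable one_ne_zero x)
      (h₂.contDiff.differentiable one_ne_zero x), h₁.dirac, h₂.dirac, sub_zero]
  · exact sub_eq_zero.2 (congrFun h u)
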